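/- Let $K$ be a field of characteristic $0$, let $e_1,\dots,e_7$ be the standard basis of $K^7$, and let $$\operatorname{per}_7=\sum_{\sigma\in\Sigma_7} e_{\sigma(1)}\otimes\cdots\otimes e_{\sigma(7)},\qquad \det\nolimits_7=\sum_{\sigma\in\Sigma_7}\operatorname{sgn}(\sigma)\, e_{\sigma(1)}\otimes\cdots\otimes e_{\sigma(7)}$$ in $(K^7)^{\otimes 7}$. For a tensor $T\in V_1\otimes\cdots\otimes V_n$, the tensor rank $\operatorname{trk}(T)$ is the smallest $r$ such that $T$ is a sum of $r$ simple tensors $v_1\otimes\cdots\otimes v_n$, and the border rank $\operatorname{brk}(T)$ is the smallest $r$ such that $T$ lies in the Zariski closure (over $K$) of the set of tensors of tensor rank at most $r$. Then $$42\le \operatorname{brk}(\operatorname{per}_7),\ \operatorname{trk}(\operatorname{per}_7)\le 64 \qquad\text{and}\qquad 62\le \operatorname{brk}(\det\nolimits_7),\ \operatorname{trk}(\det\nolimits_7)\le \left(\tfrac56\right)^{2} 7! = 3500 .$$ -/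

import Mathlib

open scoped TensorProduct

noncomputable section

section TensorRank

universe u v w

variable {ι : Type u} {K : Type v} [Field K] {V : ι → Type w}
  [∀ i, AddCommGroup (V i)] [∀ i, Module K (V i)]

/-- `IsSumOfSimple r T` says that `T = T₁ + ⋯ + T_r` where each `T_j` is a simple tensor
`⨂ᵢ v_{j,i}`. -/
def IsSumOfSimple (r : ℕ) (T : ⨂[K] i, V i) : Prop :=
  ∃ v : Fin r → (i : ι) → V i, T = ∑ j, PiTensorProduct.tprod K (v j)

/-- The tensor rank: the smallest `r` such that `T` is a sum of `r` simple tensors.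
By `exists_isSumOfSimple` below (for a nonempty index set), the set is nonempty. -/
def tensorRank (T : ⨂[K] i, V i) : ℕ :=
  sInf {r : ℕ | IsSumOfSimple r T}

end TensorRank

section Zariski

universe v w

variable (K : Type v) [Field K] (U : Type w) [AddCommGroup U] [Module K U]

/-- The algebra of polynomial functions on a `K`-vector space `U`: the algebra of functions
`U → K` generated by the linear functionals (that is, by the coordinates). -/
def polyFunctionAlgebra : Subalgebra K (U → K) :=
  Algebra.adjoin K {f : U → K | ∃ φ : U →ₗ[K] K, f = φ}

variable {U}

/-- The Zariski closure of `S ⊆ U`: the common zeros of all polynomial functions vanishing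
on `S`. -/
def zariskiClosure (S : Set U) : Set U :=
  {x | ∀ f ∈ polyFunctionAlgebra K U, (∀ y ∈ S, f y = 0) → f x = 0}

end Zariski

section BorderRank

universe u v w

variable {ι : Type u} {K : Type v} [Field K] {V : ι → Type w}
  [∀ i, AddCommGroup (V i)] [∀ i, Module K (V i)]

/-- The border rank: the smallest `r` such that `T` lies in the Zariski closure of the set of
tensors of rank at most `r`. -/
def borderRank (T : ⨂[K] i, V i) : ℕ :=
  sInf {r : ℕ | T ∈ zariskiClosure K {S : ⨂[K] i, V i | tensorRank S ≤ r}}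

end BorderRank

section DetPer

universe v

variable (K : Type v) [Field K] (n : ℕ)

/-- `det_n = ∑_σ sgn(σ) e_{σ(1)} ⊗ ⋯ ⊗ e_{σ(n)} ∈ (K^n)^{⊗ n}`. -/
def detTensor : ⨂[K] _ : Fin n, (Fin n → K) :=
  ∑ σ : Equiv.Perm (Fin n), ((Equiv.Perm.sign σ : ℤ) : K) •
    PiTensorProduct.tprod K (fun i : Fin n => (Pi.single (σ i) 1 : Fin n → K))

/-- `per_n = ∑_σ e_{σ(1)} ⊗ ⋯ ⊗ e_{σ(n)} ∈ (K^n)^{⊗ n}`. -/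
def perTensor : ⨂[K] _ : Fin n, (Fin n → K) :=
  ∑ σ : Equiv.Perm (Fin n),
    PiTensorProduct.tprod K (fun i : Fin n => (Pi.single (σ i) 1 : Fin n → K))

end DetPer

section Facts

universe u v w

variable {ι : Type u} {K : Type v} [Field K] {V : ι → Type w}
  [∀ i, AddCommGroup (V i)] [∀ i, Module K (V i)]

theorem exists_isSumOfSimple [Nonempty ι] (T : ⨂[K] i, V i) : ∃ r, IsSumOfSimple r T := by
  classical
  induction T using PiTensorProduct.induction_on with
  | smul_tprod c f =>
    obtain ⟨i⟩ := ‹Nonempty ι›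
    refine ⟨1, fun _ => Function.update f i (c • f i), ?_⟩
    simp [MultilinearMap.map_update_smul]
  | add x y hx hy =>
    obtain ⟨r, v, rfl⟩ := hx
    obtain ⟨s, w, rfl⟩ := hy
    exact ⟨r + s, Fin.append v w, by simp [Fin.sum_univ_add]⟩

theorem isSumOfSimple_tensorRank [Nonempty ι] (T : ⨂[K] i, V i) :
    IsSumOfSimple (tensorRank T) T :=
  Nat.sInf_mem (exists_isSumOfSimple T)

theorem borderRank_le_tensorRank (T : ⨂[K] i, V i) : borderRank T ≤ tensorRank T :=
  Nat.sInf_le fun _ _ h => h T (le_refl (tensorRank T))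

end Facts

end

/-!
The upper bounds come from explicit decompositions. Glynn's formula writes `per_{n+1}` as a
signed sum of `2^n` powers of sign vectors (`perTensor_eq_glynn`). For the determinant, Laplace
expansion along the first `m` positions, that is, summation over the cosets of the group of block
permutations (`detTensor_add`), gives `trk det_{m+n} ≤ (m+n choose m) · trk det_m · trk det_n`;
with Derksen's five term expression of `det_3` and the splitting `7 = 3 + 3 + 1` this is
`35 · 5 · 4 · 5 = 3500`.

The lower bounds come from a Koszul flattening. Put `n = 2p + 1` and `V = K^n`. A tensor in
`V ⊗ V^{⊗ p} ⊗ V^{⊗ p}` is sent to the matrix of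
`Λ^p V ⊗ (V^{⊗ p})* → Λ^{p+1} V ⊗ V^{⊗ p}`, contraction followed by the wedge product
(`koszulFlattening`). On a simple tensor it is the Kronecker product of `ω ↦ v ∧ ω` with a rank
one matrix, so by the relation `v ∧ v = 0` its rank is at most `(2p choose p)`
(`rank_koszulFlattening_tprod_le`). Minors are polynomial functions, so the rank of the
flattening of `T` is at most `(2p choose p)` times the border rank of `T`
(`card_le_mul_borderRank`).

For both tensors the flattening sends a pair `(P, I)` of `p`-subsets to the signed sum of the pairs
`(P ∪ {a}, I ∪ {a})` with `a ∉ P ∪ I`, and so preserves `P \ I` and `I \ P`.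
* For the determinant the signs can be removed by rescaling basis vectors (`gaugeSign`), and
  there remain the inclusion matrices between the `k`-subsets and the `(k+1)`-subsets of a
  `(2k+1)`-set. They are invertible in characteristic `0`, with an explicit inverse
  (`sum_inclusionInverse`). Hence the flattening has rank `(n choose p)^2`, which is `35^2` for
  `n = 7`, and `35^2 / 20 > 61`.
* For the permanent only the sign of the wedge product remains, and there remain differentials of
  Koszul complexes. Choosing for each class the least index `m` outside `P \ I` and `I \ P`, the
  columns with `m ∉ P` and the rows `(P ∪ {m}, I ∪ {m})` form a diagonal block with entries `±1`
  (`koszulFlattening_perTensor_submatrix`). For `n = 7` there are more than `820` such columns,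
  and `820 / 20 = 41`.
-/

/-! ### Coordinates of tensors -/

section Coordinates

variable {K : Type*} [Field K] {n : ℕ}

/-- The coefficient of `e_{w 0} ⊗ ⋯ ⊗ e_{w (n-1)}` in a tensor of order `n` over `K^d`. -/
noncomputable def tensorCoord {d : ℕ} (w : Fin n → Fin d) :
    (⨂[K] _ : Fin n, (Fin d → K)) →ₗ[K] K :=
  PiTensorProduct.lift
    ((MultilinearMap.mkPiAlgebra K (Fin n) K).compLinearMap fun i => LinearMap.proj (w i))

@[simp]
theorem tensorCoord_tprod {d : ℕ} (w : Fin n → Fin d) (v : Fin n → Fin d → K) :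
    tensorCoord w (PiTensorProduct.tprod K v) = ∏ i, v i (w i) := by
  simp [tensorCoord]

theorem tprod_eq_sum_tensorCoord {d : ℕ} (v : Fin n → Fin d → K) :
    PiTensorProduct.tprod K v =
      ∑ w : Fin n → Fin d, (∏ i, v i (w i)) •
        PiTensorProduct.tprod K (fun i => (Pi.single (w i) 1 : Fin d → K)) := by
  have h : v = fun i => ∑ j, v i j • (Pi.single j 1 : Fin d → K) := by
    funext i
    exact pi_eq_sum_univ' (v i)
  conv_lhs => rw [h]
  rw [MultilinearMap.map_sum]
  exact Finset.sum_congr rfl fun w _ => MultilinearMap.map_smul_univ _ _ _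

theorem eq_sum_tensorCoord {d : ℕ} (T : ⨂[K] _ : Fin n, (Fin d → K)) :
    T = ∑ w : Fin n → Fin d, tensorCoord w T •
        PiTensorProduct.tprod K (fun i => (Pi.single (w i) 1 : Fin d → K)) := by
  induction T using PiTensorProduct.induction_on with
  | smul_tprod c f =>
    conv_lhs => rw [tprod_eq_sum_tensorCoord f, Finset.smul_sum]
    simp [smul_smul]
  | add x y hx hy =>
    conv_lhs => rw [hx, hy]
    simp [add_smul, Finset.sum_add_distrib]

theorem tensor_ext_coord {d : ℕ} {S T : ⨂[K] _ : Fin n, (Fin d → K)}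
    (h : ∀ w, tensorCoord w S = tensorCoord w T) : S = T := by
  rw [eq_sum_tensorCoord S, eq_sum_tensorCoord T]
  simp [h]

theorem tensorCoord_tprod_single {d : ℕ} (w u : Fin n → Fin d) :
    tensorCoord w (PiTensorProduct.tprod K fun i => (Pi.single (u i) 1 : Fin d → K)) =
      if w = u then 1 else 0 := by
  classical
  rw [tensorCoord_tprod]
  simp only [Pi.single_apply]
  rw [Finset.prod_ite_zero]
  simp [funext_iff]

theorem tensorCoord_detTensor (w : Fin n → Fin n) :
    tensorCoord w (detTensor K n) =
      ∑ σ : Equiv.Perm (Fin n), if w = σ then ((Equiv.Perm.sign σ : ℤ) : K) else 0 := by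
  simp only [detTensor, map_sum, map_smul, tensorCoord_tprod_single]
  simp

theorem tensorCoord_perTensor (w : Fin n → Fin n) :
    tensorCoord w (perTensor K n) =
      ∑ σ : Equiv.Perm (Fin n), if w = σ then (1 : K) else 0 := by
  simp only [perTensor, map_sum, tensorCoord_tprod_single]

theorem tensorCoord_detTensor_perm (π : Equiv.Perm (Fin n)) :
    tensorCoord π (detTensor K n) = ((Equiv.Perm.sign π : ℤ) : K) := by
  rw [tensorCoord_detTensor]
  simp

theorem tensorCoord_perTensor_perm (π : Equiv.Perm (Fin n)) :
    tensorCoord π (perTensor K n) = 1 := by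
  rw [tensorCoord_perTensor]
  simp

theorem tensorCoord_detTensor_of_not_injective {w : Fin n → Fin n}
    (hw : ¬ Function.Injective w) : tensorCoord w (detTensor K n) = 0 := by
  rw [tensorCoord_detTensor]
  exact Finset.sum_eq_zero fun σ _ => if_neg fun (h : w = σ) => hw (h ▸ σ.injective)

theorem tensorCoord_perTensor_of_not_injective {w : Fin n → Fin n}
    (hw : ¬ Function.Injective w) : tensorCoord w (perTensor K n) = 0 := by
  rw [tensorCoord_perTensor]
  exact Finset.sum_eq_zero fun σ _ => if_neg fun (h : w = σ) => hw (h ▸ σ.injective)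

end Coordinates

/-! ### Sums of simple tensors -/

section SumOfSimple

variable {K : Type*} [Field K] {n : ℕ}

theorem isSumOfSimple_sum {ι α : Type*} [Fintype α] {V : ι → Type*}
    [∀ i, AddCommGroup (V i)] [∀ i, Module K (V i)] (v : α → (i : ι) → V i) :
    IsSumOfSimple (Fintype.card α) (∑ a, PiTensorProduct.tprod K (v a)) :=
  ⟨fun j => v ((Fintype.equivFin α).symm j),
    (Equiv.sum_comp (Fintype.equivFin α).symm fun a => PiTensorProduct.tprod K (v a)).symm⟩

theorem tensorRank_le {ι : Type*} {V : ι → Type*} [∀ i, AddCommGroup (V i)]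
    [∀ i, Module K (V i)] {r : ℕ} {T : ⨂[K] i, V i} (h : IsSumOfSimple r T) :
    tensorRank T ≤ r :=
  Nat.sInf_le h

theorem smul_tprod_eq_tprod [NeZero n] {M : Type*} [AddCommGroup M] [Module K M] (c : K)
    (v : Fin n → M) :
    c • PiTensorProduct.tprod K v =
      PiTensorProduct.tprod K (Function.update v 0 (c • v 0)) := by
  simp [MultilinearMap.map_update_smul]

theorem isSumOfSimple_sum_smul [NeZero n] {α : Type*} [Fintype α] {M : Type*}
    [AddCommGroup M] [Module K M] (c : α → K) (v : α → Fin n → M) :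
    IsSumOfSimple (Fintype.card α) (∑ a, c a • PiTensorProduct.tprod K (v a)) := by
  simp only [smul_tprod_eq_tprod]
  exact isSumOfSimple_sum _

end SumOfSimple

/-! ### The tensor rank of the permanent -/

section Glynn

variable {K : Type*} [Field K] {n : ℕ}

/-- The signs in Glynn's formula. Only the values at positive indices vary; the first sign
is `1`. -/
def glynnSign (δ : Fin n → ℤˣ) : Fin (n + 1) → ℤˣ :=
  Fin.cons 1 δ

theorem glynnSign_mulSingle_mul (δ : Fin n → ℤˣ) (k : Fin n) (j : Fin (n + 1)) :
    glynnSign (Pi.mulSingle k (-1) * δ) j =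
      (if j = k.succ then -1 else 1) * glynnSign δ j := by
  refine Fin.cases ?_ (fun j => ?_) j
  · simp [glynnSign, (Fin.succ_ne_zero k).symm]
  · by_cases h : j = k
    · subst h; simp [glynnSign]
    · simp [glynnSign, h]

/-- Summing `∏ₖ δₖ · ∏ᵢ δ_{w i}` over all signs gives `0` if some index `k > 0` is hit an even
number of times by `w`. A map from a set of size `n + 1` to itself which hits `n` of its values
an odd number of times is a bijection. -/
theorem sum_glynnSign_eq_zero {w : Fin (n + 1) → Fin (n + 1)}
    (hw : ¬ Function.Injective w) :
    ∑ δ : Fin n → ℤˣ, (((∏ k, glynnSign δ k) * ∏ i, glynnSign δ (w i) : ℤˣ) : ℤ) = 0 := by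
  classical
  obtain ⟨k, hk⟩ : ∃ k : Fin n, Even (Finset.univ.filter fun i => w i = k.succ).card := by
    by_contra! hodd
    simp only [Nat.not_even_iff_odd] at hodd
    apply hw
    rw [Finite.injective_iff_surjective]
    have hsum := Finset.card_eq_sum_card_fiberwise (f := w) (s := Finset.univ)
      (t := Finset.univ) (by simp)
    simp only [Finset.card_univ, Fintype.card_fin, Fin.sum_univ_succ] at hsum
    -- modulo 2, the number of points over `0` is `(n + 1) - n`
    have h0 : Odd (Finset.univ.filter fun i => w i = 0).card := by
      have hmod := congrArg (Nat.cast : ℕ → ZMod 2) hsum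
      push_cast at hmod
      rw [Finset.sum_congr rfl fun k _ => (ZMod.natCast_eq_one_iff_odd).2 (hodd k)] at hmod
      rw [← ZMod.natCast_eq_one_iff_odd]
      simp only [Finset.sum_const, Finset.card_univ, Fintype.card_fin, nsmul_eq_mul,
        mul_one] at hmod
      linear_combination -hmod
    intro j
    obtain ⟨i, hi⟩ := Finset.card_pos.1
      (show 0 < (Finset.univ.filter fun i => w i = j).card from
        Fin.cases h0.pos (fun k => (hodd k).pos) j)
    exact ⟨i, by simpa using hi⟩
  -- flipping the sign at `k` changes the sign of each summand
  set f : (Fin n → ℤˣ) → ℤ :=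
    fun δ => (((∏ k, glynnSign δ k) * ∏ i, glynnSign δ (w i) : ℤˣ) : ℤ) with hf
  have hflip : ∀ δ, f (Pi.mulSingle k (-1) * δ) = -f δ := by
    intro δ
    simp only [hf, glynnSign_mulSingle_mul, Finset.prod_mul_distrib]
    rw [Finset.prod_ite_eq' Finset.univ k.succ, Finset.prod_ite]
    simp [hk.neg_one_pow]
  have hsum : ∑ δ, f δ = -∑ δ, f δ := by
    conv_lhs => rw [← Equiv.sum_comp (Equiv.mulLeft (Pi.mulSingle k (-1) : Fin n → ℤˣ))]
    simp [hflip]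
  show ∑ δ, f δ = 0
  linarith

theorem sum_glynnSign_perm (π : Equiv.Perm (Fin (n + 1))) :
    ∑ δ : Fin n → ℤˣ, (((∏ k, glynnSign δ k) * ∏ i, glynnSign δ (π i) : ℤˣ) : ℤ) = 2 ^ n := by
  have h : ∀ δ : Fin n → ℤˣ, (∏ k, glynnSign δ k) * ∏ i, glynnSign δ (π i) = 1 := by
    intro δ
    rw [Equiv.prod_comp π (glynnSign δ)]
    exact Int.units_mul_self _
  simp [h]

/-- **Glynn's formula** for the permanent tensor. -/
theorem perTensor_eq_glynn [CharZero K] :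
    perTensor K (n + 1) = ∑ δ : Fin n → ℤˣ,
      ((2 ^ n : K)⁻¹ * ((∏ k, glynnSign δ k : ℤˣ) : ℤ)) •
        PiTensorProduct.tprod K (fun _ : Fin (n + 1) => fun j => ((glynnSign δ j : ℤ) : K)) := by
  refine tensor_ext_coord fun w => ?_
  have h : ∑ δ : Fin n → ℤˣ, (2 ^ n : K)⁻¹ * ((∏ k, glynnSign δ k : ℤˣ) : ℤ) *
      ∏ i, ((glynnSign δ (w i) : ℤ) : K) = (2 ^ n : K)⁻¹ *
        ((∑ δ : Fin n → ℤˣ,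
          (((∏ k, glynnSign δ k) * ∏ i, glynnSign δ (w i) : ℤˣ) : ℤ) : ℤ) : K) := by
    rw [Int.cast_sum, Finset.mul_sum]
    refine Finset.sum_congr rfl fun δ _ => ?_
    simp [mul_assoc]
  simp only [map_sum, map_smul, tensorCoord_tprod, smul_eq_mul]
  rw [h]
  by_cases hw : Function.Injective w
  · obtain ⟨π, rfl⟩ : ∃ π : Equiv.Perm (Fin (n + 1)), w = π :=
      ⟨Equiv.ofBijective w (Finite.injective_iff_bijective.1 hw), rfl⟩
    rw [tensorCoord_perTensor_perm, sum_glynnSign_perm]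
    simp
  · rw [tensorCoord_perTensor_of_not_injective hw, sum_glynnSign_eq_zero hw]
    simp

theorem tensorRank_perTensor_le [CharZero K] : tensorRank (perTensor K (n + 1)) ≤ 2 ^ n := by
  refine tensorRank_le ?_
  rw [perTensor_eq_glynn]
  simpa using isSumOfSimple_sum_smul (K := K) (n := n + 1) (α := Fin n → ℤˣ) _ _

end Glynn

/-! ### The tensor rank of the determinant -/

section Laplace

variable {K : Type*} [Field K]

/-- Derksen's expression of the `3 × 3` determinant as a sum of five simple tensors. -/
theorem isSumOfSimple_detTensor_three [CharZero K] : IsSumOfSimple 5 (detTensor K 3) := by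
  have h : detTensor K 3 = ∑ t : Fin 5, (![1 / 2, 1 / 2, 1, 1 / 2, 1 / 2] : Fin 5 → K) t •
      PiTensorProduct.tprod K
        ((![![![0, 1, 1], ![1, -1, 0], ![1, 1, 0]],
            ![![1, 1, 0], ![0, 1, -1], ![0, 1, 1]],
            ![![0, 1, 0], ![-1, 0, 1], ![1, 0, 1]],
            ![![0, -1, 1], ![1, 1, 0], ![-1, 1, 0]],
            ![![1, -1, 0], ![0, 1, 1], ![0, -1, 1]]] : Fin 5 → Fin 3 → Fin 3 → K) t) := by
    refine tensor_ext_coord fun w => ?_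
    have hdet : tensorCoord w (detTensor K 3) =
        Matrix.det (Matrix.of fun j i => if w i = j then (1 : K) else 0) := by
      rw [tensorCoord_detTensor, Matrix.det_apply']
      refine Finset.sum_congr rfl fun σ _ => ?_
      simp only [Matrix.of_apply]
      rw [Finset.prod_ite_zero]
      simp [funext_iff]
    rw [hdet, Matrix.det_fin_three]
    simp only [map_sum, map_smul, tensorCoord_tprod, smul_eq_mul, Fin.prod_univ_three,
      Matrix.of_apply]
    simp only [Fin.sum_univ_five]
    generalize w 0 = a
    generalize w 1 = b
    generalize w 2 = c
    fin_cases a <;> fin_cases b <;> fin_cases c <;> simp <;> norm_num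
  rw [h]
  exact isSumOfSimple_sum_smul (n := 3) (α := Fin 5) _ _

theorem isSumOfSimple_detTensor_one : IsSumOfSimple 1 (detTensor K 1) := by
  have h : detTensor K 1 = ∑ _ : Fin 1, PiTensorProduct.tprod K fun _ => Pi.single 0 1 := by
    simp [detTensor, Subsingleton.elim _ (0 : Fin 1)]
  rw [h]
  exact isSumOfSimple_sum (α := Fin 1) _

/-- Concatenation of tensors, as a bilinear map. -/
noncomputable def tensorConcat (K : Type*) [Field K] (M : Type*) [AddCommGroup M] [Module K M]
    (m n : ℕ) :
    (⨂[K] _ : Fin m, M) →ₗ[K] (⨂[K] _ : Fin n, M) →ₗ[K] ⨂[K] _ : Fin (m + n), M :=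
  (TensorProduct.mk K _ _).compr₂ (TensorPower.mulEquiv (R := K) (M := M)).toLinearMap

theorem tensorConcat_tprod {M : Type*} [AddCommGroup M] [Module K M] {m n : ℕ}
    (v : Fin m → M) (w : Fin n → M) :
    tensorConcat K M m n (PiTensorProduct.tprod K v) (PiTensorProduct.tprod K w) =
      PiTensorProduct.tprod K (Fin.append v w) :=
  TensorPower.tprod_mul_tprod K v w

/-- Pairs of permutations of the first `m` and of the last `n` indices. -/
def blockPerm (m n : ℕ) :
    Equiv.Perm (Fin m) × Equiv.Perm (Fin n) →* Equiv.Perm (Fin (m + n)) :=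
  finSumFinEquiv.permCongrHom.toMonoidHom.comp (Equiv.Perm.sumCongrHom (Fin m) (Fin n))

theorem blockPerm_injective (m n : ℕ) : Function.Injective (blockPerm m n) :=
  finSumFinEquiv.permCongrHom.injective.comp Equiv.Perm.sumCongrHom_injective

theorem blockPerm_castAdd {m n : ℕ} (x : Equiv.Perm (Fin m) × Equiv.Perm (Fin n)) (i : Fin m) :
    blockPerm m n x (Fin.castAdd n i) = Fin.castAdd n (x.1 i) := by
  simp [blockPerm, Equiv.permCongrHom]

theorem blockPerm_natAdd {m n : ℕ} (x : Equiv.Perm (Fin m) × Equiv.Perm (Fin n)) (i : Fin n) :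
    blockPerm m n x (Fin.natAdd m i) = Fin.natAdd m (x.2 i) := by
  simp [blockPerm, Equiv.permCongrHom]

theorem sign_blockPerm {m n : ℕ} (x : Equiv.Perm (Fin m) × Equiv.Perm (Fin n)) :
    Equiv.Perm.sign (blockPerm m n x) = Equiv.Perm.sign x.1 * Equiv.Perm.sign x.2 := by
  simp [blockPerm, Equiv.permCongrHom, Equiv.Perm.sign_permCongr]

theorem card_quotient_range_blockPerm (m n : ℕ) :
    Fintype.card (Equiv.Perm (Fin (m + n)) ⧸ (blockPerm m n).range) = (m + n).choose m := by
  have h := (blockPerm m n).range.card_eq_card_quotient_mul_card_subgroup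
  rw [← Nat.card_congr (MonoidHom.ofInjective (blockPerm_injective m n)).toEquiv,
    Nat.card_prod, Nat.card_perm, Nat.card_perm, Nat.card_perm] at h
  simp only [Nat.card_eq_fintype_card, Fintype.card_fin] at h
  rw [← Nat.add_choose_mul_factorial_mul_factorial m n, mul_assoc] at h
  rw [Nat.choose_symm_add]
  exact (Nat.eq_of_mul_eq_mul_right
    (Nat.mul_pos (Nat.factorial_pos m) (Nat.factorial_pos n)) h).symm

/-- A sum over a group, taken coset by coset of the image of an injective homomorphism. -/
theorem sum_eq_sum_quotient_range {G H A : Type*} [Group G] [Fintype G] [Group H] [Fintype H]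
    [AddCommMonoid A] {ψ : H →* G} (hψ : Function.Injective ψ) [Fintype (G ⧸ ψ.range)]
    (f : G → A) : ∑ g, f g = ∑ q : G ⧸ ψ.range, ∑ x, f (q.out * ψ x) := by
  rw [← Fintype.sum_prod_type' fun (q : G ⧸ ψ.range) x => f (q.out * ψ x)]
  symm
  refine Fintype.sum_bijective (fun p : (G ⧸ ψ.range) × H => p.1.out * ψ p.2) ⟨?_, ?_⟩ _ _
    fun _ => rfl
  · rintro ⟨q, x⟩ ⟨q', x'⟩ h
    have hq : q = q' := by
      have h' := congrArg (QuotientGroup.mk (s := ψ.range)) h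
      rwa [QuotientGroup.mk_mul_of_mem _ (MonoidHom.mem_range.2 ⟨x, rfl⟩),
        QuotientGroup.mk_mul_of_mem _ (MonoidHom.mem_range.2 ⟨x', rfl⟩),
        QuotientGroup.out_eq', QuotientGroup.out_eq'] at h'
    subst hq
    simpa [hψ.eq_iff] using h
  · intro g
    obtain ⟨x, hx⟩ : (QuotientGroup.mk (s := ψ.range) g).out⁻¹ * g ∈ ψ.range := by
      rw [← QuotientGroup.eq, QuotientGroup.out_eq']
    exact ⟨(QuotientGroup.mk g, x), by simp [hx]⟩

/-- Laplace expansion along the first `m` positions: the sum over each coset of the block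
permutations is the concatenation of relabelled determinants. -/
theorem detTensor_add (m n : ℕ) :
    detTensor K (m + n) = ∑ q : Equiv.Perm (Fin (m + n)) ⧸ (blockPerm m n).range,
      tensorConcat K (Fin (m + n) → K) m n
        (((Equiv.Perm.sign q.out : ℤ) : K) • PiTensorProduct.map
          (fun _ => (Pi.basisFun K (Fin m)).constr K
            fun i => Pi.single (q.out (Fin.castAdd n i)) 1) (detTensor K m))
        (PiTensorProduct.map
          (fun _ => (Pi.basisFun K (Fin n)).constr K
            fun i => Pi.single (q.out (Fin.natAdd m i)) 1) (detTensor K n)) := by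
  rw [detTensor, sum_eq_sum_quotient_range (blockPerm_injective m n)]
  refine Finset.sum_congr rfl fun q _ => ?_
  have hb : ∀ {k : ℕ} (u : Fin k → Fin (m + n) → K) (i : Fin k),
      (Pi.basisFun K (Fin k)).constr K u (Pi.single i 1) = u i := by
    intro k u i
    rw [← Pi.basisFun_apply, Module.Basis.constr_basis]
  simp only [detTensor, map_sum, map_smul, PiTensorProduct.map_tprod, hb, Finset.smul_sum,
    LinearMap.sum_apply, LinearMap.smul_apply, tensorConcat_tprod]
  rw [Fintype.sum_prod_type_right]
  refine Finset.sum_congr rfl fun β _ => Finset.sum_congr rfl fun α _ => ?_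
  have hw : (fun i => (Pi.single ((q.out * blockPerm m n (α, β)) i) 1 : Fin (m + n) → K)) =
      Fin.append (fun i => Pi.single (q.out (Fin.castAdd n (α i))) 1)
        (fun i => Pi.single (q.out (Fin.natAdd m (β i))) 1) := by
    funext i
    induction i using Fin.addCases
    · rw [Fin.append_left, Equiv.Perm.mul_apply, blockPerm_castAdd]
    · rw [Fin.append_right, Equiv.Perm.mul_apply, blockPerm_natAdd]
  rw [hw, Equiv.Perm.sign_mul, sign_blockPerm, smul_smul, smul_smul]
  congr 1
  push_cast
  ring

theorem isSumOfSimple_detTensor_add {m n r s : ℕ} [NeZero m]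
    (hr : IsSumOfSimple r (detTensor K m)) (hs : IsSumOfSimple s (detTensor K n)) :
    IsSumOfSimple ((m + n).choose m * (r * s)) (detTensor K (m + n)) := by
  obtain ⟨v, hv⟩ := hr
  obtain ⟨w, hw⟩ := hs
  rw [detTensor_add, hv, hw]
  simp only [map_sum, PiTensorProduct.map_tprod, Finset.smul_sum, LinearMap.sum_apply,
    smul_tprod_eq_tprod, tensorConcat_tprod]
  simp only [← Fintype.sum_prod_type']
  convert isSumOfSimple_sum (K := K) (ι := Fin (m + n)) _ using 1
  rw [← card_quotient_range_blockPerm]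
  simp [mul_comm, mul_assoc]

theorem tensorRank_detTensor_seven_le [CharZero K] : tensorRank (detTensor K 7) ≤ 3500 :=
  tensorRank_le <| isSumOfSimple_detTensor_add (m := 3) (n := 4) isSumOfSimple_detTensor_three <|
    isSumOfSimple_detTensor_add (m := 3) (n := 1) isSumOfSimple_detTensor_three
      isSumOfSimple_detTensor_one

end Laplace

/-! ### Border rank bounds from linear flattenings -/

section Flattening

theorem Matrix.rank_add_le_rank_add_rank {m n K : Type*} [Finite m] [Fintype n] [Field K]
    (A B : Matrix m n K) : (A + B).rank ≤ A.rank + B.rank := by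
  have := Fintype.ofFinite m
  unfold Matrix.rank
  rw [Matrix.mulVecLin_add]
  exact (Submodule.finrank_mono (LinearMap.range_add_le _ _)).trans
    (Submodule.finrank_add_le_finrank_add_finrank _ _)

theorem Matrix.rank_sum_le_of_forall_le {m n α K : Type*} [Finite m] [Fintype n] [Field K]
    (s : Finset α) (M : α → Matrix m n K) {k : ℕ} (h : ∀ a, (M a).rank ≤ k) :
    (∑ a ∈ s, M a).rank ≤ k * s.card := by
  classical
  induction s using Finset.induction_on with
  | empty => simp
  | insert a s ha ih =>
    rw [Finset.sum_insert ha, Finset.card_insert_of_notMem ha]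
    have := Matrix.rank_add_le_rank_add_rank (M a) (∑ a ∈ s, M a)
    have := h a
    lia

variable {ι : Type*} {K : Type*} [Field K] {V : ι → Type*}
  [∀ i, AddCommGroup (V i)] [∀ i, Module K (V i)]

theorem mem_zariskiClosure_tensorRank_le_borderRank (T : ⨂[K] i, V i) :
    T ∈ zariskiClosure K {S : ⨂[K] i, V i | tensorRank S ≤ borderRank T} :=
  Nat.sInf_mem (s := {r : ℕ | T ∈ zariskiClosure K {S : ⨂[K] i, V i | tensorRank S ≤ r}})
    ⟨tensorRank T, fun _ _ h => h T (le_refl (tensorRank T))⟩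

theorem det_mem_polyFunctionAlgebra {U κ : Type*} [AddCommGroup U] [Module K U] [Fintype κ]
    [DecidableEq κ] (Ψ : U →ₗ[K] Matrix κ κ K) :
    (fun S => (Ψ S).det) ∈ polyFunctionAlgebra K U := by
  have h : (fun S => (Ψ S).det) = ∑ σ : Equiv.Perm κ,
      ((Equiv.Perm.sign σ : ℤ) : K) • ∏ i, fun S => Ψ S (σ i) i := by
    funext S
    simp [Matrix.det_apply', Finset.sum_apply, Finset.prod_apply]
  rw [h]
  refine Subalgebra.sum_mem _ fun σ _ => Subalgebra.smul_mem _ (Subalgebra.prod_mem _ ?_) _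
  exact fun i _ => Algebra.subset_adjoin ⟨(Matrix.entryLinearMap K K (σ i) i).comp Ψ, rfl⟩

/-- If a linear map `Φ` from tensors to matrices sends simple tensors to matrices of rank at
most `k`, then the border rank of `T` is at least `rank (Φ T) / k`. The lower bound on the rank
of `Φ T` is given as an invertible square matrix `A * Φ T * B`: its determinant is a polynomial
function of `T` which vanishes on tensors of small rank. -/
theorem card_le_mul_borderRank [Nonempty ι] {m n κ : Type*} [Fintype m] [Fintype n]
    [Fintype κ] [DecidableEq κ] (Φ : (⨂[K] i, V i) →ₗ[K] Matrix m n K) {k : ℕ}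
    (hk : ∀ v, (Φ (PiTensorProduct.tprod K v)).rank ≤ k) {T : ⨂[K] i, V i}
    (A : Matrix κ m K) (B : Matrix n κ K) (hdet : (A * Φ T * B).det ≠ 0) :
    Fintype.card κ ≤ k * borderRank T := by
  by_contra! hlt
  let Ψ : (⨂[K] i, V i) →ₗ[K] Matrix κ κ K :=
    { toFun := fun S => A * Φ S * B
      map_add' := fun S S' => by rw [map_add, Matrix.mul_add, Matrix.add_mul]
      map_smul' := fun c S => by simp }
  refine hdet (mem_zariskiClosure_tensorRank_le_borderRank T _
    (det_mem_polyFunctionAlgebra Ψ) fun S hS => ?_)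
  obtain ⟨v, hv⟩ := isSumOfSimple_tensorRank S
  have hrank : (Φ S).rank ≤ k * tensorRank S := by
    have h := Matrix.rank_sum_le_of_forall_le Finset.univ
      (fun j => Φ (PiTensorProduct.tprod K (v j))) fun j => hk (v j)
    rwa [← map_sum, ← hv, Finset.card_univ, Fintype.card_fin] at h
  have hrank' : (A * Φ S * B).rank ≤ k * borderRank T :=
    ((Matrix.rank_mul_le_left _ _).trans (Matrix.rank_mul_le_right _ _)).trans
      (hrank.trans (Nat.mul_le_mul_left k hS))
  by_contra hne
  have := Matrix.rank_of_isUnit (A * Φ S * B)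
    ((Matrix.isUnit_iff_isUnit_det _).2 (Ne.isUnit hne))
  lia

theorem card_le_mul_borderRank_of_submatrix [Nonempty ι] {m n κ : Type*} [Fintype m] [Fintype n]
    [Fintype κ] [DecidableEq κ] (Φ : (⨂[K] i, V i) →ₗ[K] Matrix m n K) {k : ℕ}
    (hk : ∀ v, (Φ (PiTensorProduct.tprod K v)).rank ≤ k) {T : ⨂[K] i, V i}
    (f : κ → m) (g : κ → n) (hdet : ((Φ T).submatrix f g).det ≠ 0) :
    Fintype.card κ ≤ k * borderRank T := by
  classical
  refine card_le_mul_borderRank Φ hk ((1 : Matrix m m K).submatrix f id)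
    ((1 : Matrix n n K).submatrix id g) ?_
  convert hdet using 2
  ext i j
  simp [Matrix.mul_apply, Matrix.one_apply]

end Flattening

/-! ### The Koszul complex -/

section Koszul

/-- The sign of `b - a`; in particular `0` for `a = b`. -/
def orderSign {n : ℕ} (a b : Fin n) : ℤ :=
  if a < b then 1 else if b < a then -1 else 0

/-- The sign `s` with `e_a ∧ e_P = s • e_{P ∪ {a}}`, where `e_P` is the wedge product of the
`e_b`, `b ∈ P`, in increasing order. It is `0` for `a ∈ P`. -/
def koszulSign {n : ℕ} (a : Fin n) (P : Finset (Fin n)) : ℤ :=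
  ∏ b ∈ P, orderSign a b

variable {n : ℕ}

theorem orderSign_swap (a b : Fin n) : orderSign b a = -orderSign a b := by
  unfold orderSign
  split_ifs <;> first | rfl | lia

theorem orderSign_self (a : Fin n) : orderSign a a = 0 := by
  simp [orderSign]

theorem orderSign_mul_self {a b : Fin n} (h : a ≠ b) : orderSign a b * orderSign a b = 1 := by
  rcases lt_or_gt_of_ne h with h | h <;> simp [orderSign, h, h.not_gt]

theorem koszulSign_of_mem {a : Fin n} {P : Finset (Fin n)} (h : a ∈ P) : koszulSign a P = 0 :=
  Finset.prod_eq_zero h (orderSign_self a)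

theorem koszulSign_mul_self {a : Fin n} {P : Finset (Fin n)} (h : a ∉ P) :
    koszulSign a P * koszulSign a P = 1 := by
  rw [koszulSign, ← Finset.prod_mul_distrib]
  exact Finset.prod_eq_one fun b hb => orderSign_mul_self fun hab => h (hab ▸ hb)

theorem koszulSign_insert {a : Fin n} {P : Finset (Fin n)} (h : a ∉ P) (b : Fin n) :
    koszulSign b (insert a P) = orderSign b a * koszulSign b P :=
  Finset.prod_insert h

variable {K : Type*} [Field K]

theorem koszulSign_cast_ne_zero [CharZero K] {a : Fin n} {P : Finset (Fin n)}
    (h : a ∉ P) : (koszulSign a P : K) ≠ 0 := by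
  intro h0
  have h1 := koszulSign_mul_self h
  rw [Int.cast_eq_zero.1 h0] at h1
  simp at h1

/-- The vector `v ∧ e_P`, in coordinates indexed by the subsets of `Fin n`. -/
def wedgeVec (v : Fin n → K) (P : Finset (Fin n)) : Finset (Fin n) → K :=
  ∑ a, (koszulSign a P * v a : K) • Pi.single (insert a P) 1

theorem wedgeVec_apply (v : Fin n → K) (P P' : Finset (Fin n)) :
    wedgeVec v P P' = ∑ a, if P' = insert a P then (koszulSign a P * v a : K) else 0 := by
  simp [wedgeVec, Finset.sum_apply, Pi.single_apply]

/-- The relation `v ∧ (v ∧ e_Q) = 0`. -/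
theorem sum_smul_wedgeVec_insert [CharZero K] (v : Fin n → K) (Q : Finset (Fin n)) :
    ∑ a, (koszulSign a Q * v a : K) • wedgeVec v (insert a Q) = 0 := by
  set F : Fin n → Fin n → Finset (Fin n) → K := fun a b =>
    (koszulSign a Q * v a * (orderSign b a * koszulSign b Q * v b) : K) •
      Pi.single (insert b (insert a Q)) 1 with hF
  have h : ∀ a, (koszulSign a Q * v a : K) • wedgeVec v (insert a Q) = ∑ b, F a b := by
    intro a
    by_cases ha : a ∈ Q
    · simp [hF, koszulSign_of_mem ha]
    · simp [hF, wedgeVec, koszulSign_insert ha, Finset.smul_sum, smul_smul]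
  have hswap : ∀ a b, F b a = -F a b := by
    intro a b
    simp only [hF]
    rw [orderSign_swap b a, Finset.insert_comm, ← neg_smul]
    congr 1
    push_cast
    ring
  simp only [h]
  refine self_eq_neg.1 ?_
  conv_lhs => rw [Finset.sum_comm]
  simp only [← Finset.sum_neg_distrib, ← hswap]

/-- If `v a₀ ≠ 0`, the vectors `v ∧ e_P` with `a₀ ∉ P` and `|P| = p` span all `v ∧ e_P` with
`|P| = p`. -/
theorem wedgeVec_mem_span [CharZero K] {v : Fin n → K} {a₀ : Fin n} (ha₀ : v a₀ ≠ 0)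
    (P : Finset (Fin n)) :
    wedgeVec v P ∈ Submodule.span K (wedgeVec v ''
      (Finset.powersetCard P.card (Finset.univ.erase a₀) : Set (Finset (Fin n)))) := by
  set W := Submodule.span K (wedgeVec v ''
    (Finset.powersetCard P.card (Finset.univ.erase a₀) : Set (Finset (Fin n)))) with hW
  have hmem : ∀ P' : Finset (Fin n), a₀ ∉ P' → P'.card = P.card → wedgeVec v P' ∈ W := by
    intro P' h hc
    refine Submodule.subset_span ⟨P', ?_, rfl⟩
    rw [Finset.mem_coe, Finset.mem_powersetCard]
    exact ⟨fun b hb => Finset.mem_erase.2 ⟨fun e => h (e ▸ hb), Finset.mem_univ b⟩, hc⟩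
  by_cases hP : a₀ ∈ P
  · -- solve the Koszul relation for `Q = P \ {a₀}` for the term of `a₀`
    set Q := P.erase a₀ with hQ
    have hQP : insert a₀ Q = P := Finset.insert_erase hP
    have hQ₀ : a₀ ∉ Q := Finset.notMem_erase a₀ P
    have hrel := sum_smul_wedgeVec_insert v Q
    rw [← Finset.add_sum_erase _ _ (Finset.mem_univ a₀), hQP] at hrel
    have hs : (koszulSign a₀ Q * v a₀ : K) ≠ 0 :=
      mul_ne_zero (koszulSign_cast_ne_zero hQ₀) ha₀
    rw [← Submodule.smul_mem_iff W hs, eq_neg_of_add_eq_zero_left hrel]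
    refine W.neg_mem (W.sum_mem fun a ha => ?_)
    by_cases haQ : a ∈ Q
    · simp [koszulSign_of_mem haQ]
    · refine W.smul_mem _ (hmem _ ?_ ?_)
      · simp [hQ₀, (Finset.ne_of_mem_erase ha).symm]
      · rw [Finset.card_insert_of_notMem haQ, ← hQP, Finset.card_insert_of_notMem hQ₀]
  · exact hmem P hP rfl

/-- The type of subsets of `Fin n` of size `p`. -/
abbrev KSubset (n p : ℕ) : Type := {P : Finset (Fin n) // P.card = p}

/-- The matrix of `ω ↦ v ∧ ω` on the `p`-th exterior power. -/
def wedgeMatrix (p : ℕ) (v : Fin n → K) : Matrix (Finset (Fin n)) (KSubset n p) K :=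
  Matrix.of fun P' P => wedgeVec v P P'

theorem rank_wedgeMatrix_le [CharZero K] (p : ℕ) (v : Fin n → K) :
    (wedgeMatrix p v).rank ≤ (n - 1).choose p := by
  classical
  by_cases hv : v = 0
  · have h : wedgeMatrix p v = 0 := by
      ext P' P
      simp [wedgeMatrix, hv, wedgeVec]
    simp [h]
  obtain ⟨a₀, ha₀⟩ : ∃ a₀, v a₀ ≠ 0 := Function.ne_iff.1 hv
  rw [Matrix.rank_eq_finrank_span_cols]
  have hsub : Submodule.span K (Set.range (wedgeMatrix p v).col) ≤ Submodule.span K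
      (((Finset.powersetCard p (Finset.univ.erase a₀)).image (wedgeVec v) :
        Finset (Finset (Fin n) → K)) : Set (Finset (Fin n) → K)) := by
    rw [Submodule.span_le]
    rintro _ ⟨P, rfl⟩
    have h := wedgeVec_mem_span ha₀ P.1
    rw [P.2] at h
    rw [Finset.coe_image]
    exact h
  calc _ ≤ _ := Submodule.finrank_mono hsub
    _ ≤ _ := finrank_span_finset_le_card _
    _ ≤ _ := Finset.card_image_le
    _ = _ := by simp

end Koszul

/-! ### The Koszul flattening of a tensor of odd order -/

section KoszulFlattening

variable {K : Type*} [Field K] {p : ℕ}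

/-- The word consisting of a letter `a`, then the elements of `I` in increasing order, then the
elements of `J` in increasing order. -/
def tripleWord (a : Fin (p + p + 1)) (I J : KSubset (p + p + 1) p) :
    Fin (p + p + 1) → Fin (p + p + 1) :=
  Fin.cons a (Fin.append (I.1.orderEmbOfFin I.2) (J.1.orderEmbOfFin J.2))

/-- For a tensor `T` in `V ⊗ V^{⊗ p} ⊗ V^{⊗ p}` with `V = K^(2p+1)`, the matrix of
`Λ^p V ⊗ (V^{⊗ p})* → Λ^{p+1} V ⊗ V^{⊗ p}` given by contraction with `T` followed by the wedge
product, restricted to the basis vectors of `V^{⊗ p}` belonging to increasing words. Rows are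
indexed by pairs `(P', J)` with `P'` an arbitrary subset; those with `|P'| ≠ p + 1` vanish. -/
noncomputable def koszulFlattening :
    (⨂[K] _ : Fin (p + p + 1), (Fin (p + p + 1) → K)) →ₗ[K]
      Matrix (Finset (Fin (p + p + 1)) × KSubset (p + p + 1) p)
        (KSubset (p + p + 1) p × KSubset (p + p + 1) p) K where
  toFun T := Matrix.of fun r c => ∑ a, if r.1 = insert a c.1.1 then
    (koszulSign a c.1.1 * tensorCoord (tripleWord a c.2 r.2) T : K) else 0
  map_add' S T := by
    ext r c
    simp only [map_add, Matrix.of_apply, Matrix.add_apply, mul_add, ← Finset.sum_add_distrib]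
    exact Finset.sum_congr rfl fun a _ => by split_ifs <;> simp
  map_smul' x T := by
    ext r c
    simp only [map_smul, Matrix.of_apply, Matrix.smul_apply, smul_eq_mul, RingHom.id_apply,
      Finset.mul_sum]
    exact Finset.sum_congr rfl fun a _ => by split_ifs <;> ring

theorem koszulFlattening_apply (T : ⨂[K] _ : Fin (p + p + 1), (Fin (p + p + 1) → K))
    (r : Finset (Fin (p + p + 1)) × KSubset (p + p + 1) p)
    (c : KSubset (p + p + 1) p × KSubset (p + p + 1) p) :
    koszulFlattening T r c = ∑ a, if r.1 = insert a c.1.1 then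
      (koszulSign a c.1.1 * tensorCoord (tripleWord a c.2 r.2) T : K) else 0 :=
  rfl

theorem rank_koszulFlattening_tprod_le [CharZero K]
    (v : Fin (p + p + 1) → Fin (p + p + 1) → K) :
    (koszulFlattening (PiTensorProduct.tprod K v)).rank ≤ (p + p).choose p := by
  classical
  -- the flattening of a simple tensor is a Kronecker product of `v₀ ∧ ·` with a rank one matrix
  set α : KSubset (p + p + 1) p → K := fun I =>
    ∏ i : Fin p, v (Fin.castAdd p i).succ (I.1.orderEmbOfFin I.2 i) with hα
  set β : KSubset (p + p + 1) p → K := fun J =>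
    ∏ i : Fin p, v (Fin.natAdd p i).succ (J.1.orderEmbOfFin J.2 i) with hβ
  have hcoord : ∀ a I J,
      tensorCoord (tripleWord a I J) (PiTensorProduct.tprod K v) = v 0 a * (α I * β J) := by
    intro a I J
    rw [tensorCoord_tprod, Fin.prod_univ_succ, Fin.prod_univ_add]
    simp only [tripleWord, Fin.cons_zero, Fin.cons_succ, Fin.append_left, Fin.append_right, hα, hβ]
  have hfac : koszulFlattening (PiTensorProduct.tprod K v) =
      (Matrix.of fun r P' => if r.1 = P' then β r.2 else 0 :
          Matrix (Finset (Fin (p + p + 1)) × KSubset (p + p + 1) p) _ K) *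
        wedgeMatrix p (v 0) *
        (Matrix.of fun P c => if P = c.1 then α c.2 else 0 :
          Matrix _ (KSubset (p + p + 1) p × KSubset (p + p + 1) p) K) := by
    ext r c
    simp only [koszulFlattening_apply, hcoord, Matrix.mul_apply, Matrix.of_apply, ite_mul,
      zero_mul, mul_ite, mul_zero, Finset.sum_ite_eq', Finset.mem_univ,
      if_true, wedgeMatrix, wedgeVec_apply, Finset.mul_sum, Finset.sum_mul]
    rw [Finset.sum_comm]
    refine Finset.sum_congr rfl fun a _ => ?_
    rw [Finset.sum_ite_eq', if_pos (Finset.mem_univ _)]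
    split_ifs <;> ring
  rw [hfac]
  exact ((Matrix.rank_mul_le_left _ _).trans (Matrix.rank_mul_le_right _ _)).trans
    (rank_wedgeMatrix_le p (v 0))

/-- The word of `(a, I, J)` is a permutation exactly if `{a}`, `I`, `J` partition the index
set. -/
theorem tripleWord_injective_iff {a : Fin (p + p + 1)} {I J : KSubset (p + p + 1) p} :
    Function.Injective (tripleWord a I J) ↔ a ∉ I.1 ∧ J.1 = (insert a I.1)ᶜ := by
  have hcard : ∀ h : a ∉ I.1, (insert a I.1)ᶜ.card = p := by
    intro h
    rw [Finset.card_compl, Finset.card_insert_of_notMem h, I.2, Fintype.card_fin]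
    lia
  have hmem : ∀ (S : KSubset (p + p + 1) p) (b : Fin (p + p + 1)),
      b ∈ Set.range (S.1.orderEmbOfFin S.2) ↔ b ∈ S.1 := by simp
  have hJ : a ∉ I.1 ∧ J.1 = (insert a I.1)ᶜ ↔ a ∉ I.1 ∧ a ∉ J.1 ∧ Disjoint I.1 J.1 := by
    refine and_congr_right fun h => ⟨fun e => ?_, fun e => ?_⟩
    · rw [e]
      refine ⟨by simp, ?_⟩
      exact disjoint_compl_right.mono_left (Finset.subset_insert a I.1)
    · refine Finset.eq_of_subset_of_card_le (fun b hb => ?_) (by rw [hcard h, J.2])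
      have h2 : b ∉ I.1 := fun hI => Finset.disjoint_left.1 e.2 hI hb
      have h3 : b ≠ a := fun hba => e.1 (hba ▸ hb)
      simp [h2, h3]
  have hdisj : Disjoint I.1 J.1 ↔
      ∀ i j, I.1.orderEmbOfFin I.2 i ≠ J.1.orderEmbOfFin J.2 j := by
    rw [← Finset.disjoint_coe, ← Finset.range_orderEmbOfFin I.1 I.2,
      ← Finset.range_orderEmbOfFin J.1 J.2, Set.disjoint_range_iff]
  have hrange : a ∉ Set.range
      (Fin.append (I.1.orderEmbOfFin I.2) (J.1.orderEmbOfFin J.2)) ↔ a ∉ I.1 ∧ a ∉ J.1 := by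
    rw [← hmem I a, ← hmem J a, ← not_or, not_iff_not]
    constructor
    · rintro ⟨i, rfl⟩
      induction i using Fin.addCases with
      | left i => exact Or.inl ⟨i, (Fin.append_left _ _ i).symm⟩
      | right i => exact Or.inr ⟨i, (Fin.append_right _ _ i).symm⟩
    · rintro (⟨i, rfl⟩ | ⟨i, rfl⟩)
      · exact ⟨Fin.castAdd p i, Fin.append_left _ _ i⟩
      · exact ⟨Fin.natAdd p i, Fin.append_right _ _ i⟩
  rw [hJ, tripleWord, Fin.cons_injective_iff, Fin.append_injective_iff, hrange, hdisj]
  simp [(I.1.orderEmbOfFin I.2).injective, (J.1.orderEmbOfFin J.2).injective, and_assoc]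

theorem tensorCoord_tripleWord_perTensor (a : Fin (p + p + 1)) (I J : KSubset (p + p + 1) p) :
    tensorCoord (tripleWord a I J) (perTensor K (p + p + 1)) =
      if a ∉ I.1 ∧ J.1 = (insert a I.1)ᶜ then 1 else 0 := by
  have hiff := tripleWord_injective_iff (a := a) (I := I) (J := J)
  split_ifs with h
  · exact tensorCoord_perTensor_perm
      (Equiv.ofBijective _ (Finite.injective_iff_bijective.1 (hiff.2 h)))
  · exact tensorCoord_perTensor_of_not_injective fun h' => h (hiff.1 h')

/-- The parity of the number of pairs `b ∈ I`, `c ∉ I` with `c < b`, as a sign. -/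
def complSign {n : ℕ} (I : Finset (Fin n)) : ℤ :=
  ∏ b ∈ I, koszulSign b Iᶜ

theorem complSign_mul_self {n : ℕ} (I : Finset (Fin n)) : complSign I * complSign I = 1 := by
  rw [complSign, ← Finset.prod_mul_distrib]
  exact Finset.prod_eq_one fun b hb => koszulSign_mul_self (by simpa using hb)

theorem sign_eq_prod_orderSign {n : ℕ} (σ : Equiv.Perm (Fin n)) :
    (Equiv.Perm.sign σ : ℤ) = ∏ i, ∏ j ∈ Finset.Ioi i, orderSign (σ i) (σ j) := by
  rw [Equiv.Perm.sign_eq_prod_prod_Ioi]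
  push_cast
  refine Finset.prod_congr rfl fun i _ => Finset.prod_congr rfl fun j hj => ?_
  have h : σ i ≠ σ j := σ.injective.ne (Finset.mem_Ioi.1 hj).ne
  rcases lt_or_gt_of_ne h with h | h <;> simp [orderSign, h, h.not_gt]

theorem prod_orderEmbOfFin {n : ℕ} {M : Type*} [CommMonoid M] (I : KSubset n p) (f : Fin n → M) :
    ∏ i, f (I.1.orderEmbOfFin I.2 i) = ∏ b ∈ I.1, f b := by
  conv_rhs => rw [← Finset.map_orderEmbOfFin_univ I.1 I.2]
  rw [Finset.prod_map]
  rfl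

theorem prod_prod_Ioi_orderSign_of_strictMono {n : ℕ} {u : Fin p → Fin n} (hu : StrictMono u) :
    ∏ i, ∏ j ∈ Finset.Ioi i, orderSign (u i) (u j) = 1 :=
  Finset.prod_eq_one fun i _ => Finset.prod_eq_one fun j hj => by
    simp [orderSign, hu (Finset.mem_Ioi.1 hj)]

theorem prod_prod_Ioi_append {M α : Type*} [CommMonoid M] {m n : ℕ} (f : α → α → M)
    (u : Fin m → α) (v : Fin n → α) :
    ∏ i, ∏ j ∈ Finset.Ioi i, f (Fin.append u v i) (Fin.append u v j) =
      (∏ i, ∏ j ∈ Finset.Ioi i, f (u i) (u j)) * (∏ i, ∏ j, f (u i) (v j)) *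
        ∏ i, ∏ j ∈ Finset.Ioi i, f (v i) (v j) := by
  have h : ∀ {k : ℕ} (i : Fin k) (g : Fin k → M),
      ∏ j ∈ Finset.Ioi i, g j = ∏ j, if i < j then g j else 1 := by
    intro k i g
    rw [← Finset.prod_filter]
    congr 1
    ext j
    simp
  have h1 : ∀ (i : Fin m) (j : Fin n), Fin.castAdd n i < Fin.natAdd m j := by
    intro i j
    simp only [Fin.lt_def, Fin.val_castAdd, Fin.val_natAdd]
    lia
  have h2 : ∀ i j : Fin m, Fin.castAdd n i < Fin.castAdd n j ↔ i < j := fun _ _ => Iff.rfl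
  have h3 : ∀ i j : Fin n, Fin.natAdd m i < Fin.natAdd m j ↔ i < j := by
    intro i j
    simp only [Fin.lt_def, Fin.val_natAdd]
    lia
  simp only [h]
  rw [Fin.prod_univ_add]
  simp only [Fin.prod_univ_add, Fin.append_left, Fin.append_right, h1, h2, h3, (h1 _ _).not_gt,
    if_true, if_false, Finset.prod_const_one, one_mul, Finset.prod_mul_distrib]

theorem sign_tripleWord {a : Fin (p + p + 1)} {I J : KSubset (p + p + 1) p}
    {σ : Equiv.Perm (Fin (p + p + 1))} (hσ : ⇑σ = tripleWord a I J) (ha : a ∉ I.1)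
    (hJ : J.1 = (insert a I.1)ᶜ) :
    (Equiv.Perm.sign σ : ℤ) = koszulSign a I.1 * complSign (insert a I.1) := by
  rw [sign_eq_prod_orderSign, hσ, tripleWord, Fin.prod_univ_succ, Fin.prod_Ioi_zero]
  simp only [Fin.prod_Ioi_succ, Fin.cons_zero, Fin.cons_succ]
  rw [prod_prod_Ioi_append, Fin.prod_univ_add,
    prod_prod_Ioi_orderSign_of_strictMono (I.1.orderEmbOfFin I.2).strictMono,
    prod_prod_Ioi_orderSign_of_strictMono (J.1.orderEmbOfFin J.2).strictMono]
  simp only [Fin.append_left, Fin.append_right, prod_orderEmbOfFin]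
  rw [prod_orderEmbOfFin I fun b => ∏ c ∈ J.1, orderSign b c, complSign,
    Finset.prod_insert ha, ← hJ]
  simp only [koszulSign]
  ring

theorem tensorCoord_tripleWord_detTensor (a : Fin (p + p + 1)) (I J : KSubset (p + p + 1) p) :
    tensorCoord (tripleWord a I J) (detTensor K (p + p + 1)) =
      if a ∉ I.1 ∧ J.1 = (insert a I.1)ᶜ then
        (koszulSign a I.1 * complSign (insert a I.1) : K) else 0 := by
  classical
  have hiff := tripleWord_injective_iff (a := a) (I := I) (J := J)
  split_ifs with h
  · have h' := hiff.2 h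
    set σ := Equiv.ofBijective _ (Finite.injective_iff_bijective.1 h') with hσ
    have h2 := tensorCoord_detTensor_perm (K := K) σ
    rw [sign_tripleWord (σ := σ) rfl h.1 h.2] at h2
    exact_mod_cast h2
  · exact tensorCoord_detTensor_of_not_injective fun h' => h (hiff.1 h')

end KoszulFlattening

/-! ### The border rank of the permanent -/

section Permanent

variable {K : Type*} [Field K] {p : ℕ}

/-- The complement in `Fin (2p+1)` of a set of size `p` and one more point. -/
def complInsert (a : Fin (p + p + 1)) (I : KSubset (p + p + 1) p) (h : a ∉ I.1) :
    KSubset (p + p + 1) p :=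
  ⟨(insert a I.1)ᶜ, by
    rw [Finset.card_compl, Finset.card_insert_of_notMem h, I.2, Fintype.card_fin]
    lia⟩

/-- `m` is the least index which lies in both or in neither of `P` and `I`, and it lies in
neither. -/
def IsLeastOutside {n : ℕ} (P I : Finset (Fin n)) (m : Fin n) : Prop :=
  m ∉ P ∧ m ∉ I ∧ ∀ j < m, (j ∈ P ↔ j ∉ I)

instance {n : ℕ} (P I : Finset (Fin n)) (m : Fin n) : Decidable (IsLeastOutside P I m) :=
  inferInstanceAs (Decidable (_ ∧ _ ∧ _))

/-- Adding a common new element to `P` and `I` does not change their symmetric difference,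
which determines the least element outside. -/
theorem IsLeastOutside.eq_of_insert_eq {n : ℕ} {P I P₁ I₁ : Finset (Fin n)} {m m₁ a : Fin n}
    (h : IsLeastOutside P I m) (h₁ : IsLeastOutside P₁ I₁ m₁) (haP : a ∉ P) (haI : a ∉ I)
    (hP : insert m₁ P₁ = insert a P) (hI : insert m₁ I₁ = insert a I) :
    a = m ∧ P₁ = P ∧ I₁ = I := by
  obtain ⟨hmP, hmI, hm⟩ := h
  obtain ⟨hm₁P, hm₁I, hm₁⟩ := h₁
  have hsymm : ∀ j, (j ∈ P₁ ↔ j ∉ I₁) ↔ (j ∈ P ↔ j ∉ I) := by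
    intro j
    have h1 : j ∈ insert m₁ P₁ ↔ j ∈ insert a P := by rw [hP]
    have h2 : j ∈ insert m₁ I₁ ↔ j ∈ insert a I := by rw [hI]
    simp only [Finset.mem_insert] at h1 h2
    by_cases e1 : j = m₁ <;> by_cases e2 : j = a <;> simp_all
  have hmm : m₁ = m := by
    rcases lt_trichotomy m₁ m with hlt | heq | hlt
    · have := (hsymm m₁).2 (hm m₁ hlt)
      simp_all
    · exact heq
    · have := (hsymm m).1 (hm₁ m hlt)
      simp_all
  subst hmm
  have ham : a = m₁ := by
    have h1 : m₁ ∈ insert a P := hP ▸ Finset.mem_insert_self m₁ P₁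
    rcases Finset.mem_insert.1 h1 with h1 | h1
    · exact h1.symm
    · exact absurd h1 hmP
  subst ham
  refine ⟨rfl, ?_, ?_⟩
  · rw [← Finset.erase_insert hm₁P, hP, Finset.erase_insert hmP]
  · rw [← Finset.erase_insert hm₁I, hI, Finset.erase_insert hmI]

/-- The flattening of the permanent, restricted to columns `(P, I)` which have a least element
`m` outside and to the rows `(P ∪ {m}, I ∪ {m})`, is diagonal with entries `±1`. -/
theorem koszulFlattening_perTensor_submatrix {κ : Type*} [DecidableEq κ]
    {P I : κ → KSubset (p + p + 1) p} (hinj : Function.Injective fun c => (P c, I c))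
    {m : κ → Fin (p + p + 1)} (hm : ∀ c, IsLeastOutside (P c).1 (I c).1 (m c)) :
    (koszulFlattening (perTensor K (p + p + 1))).submatrix
      (fun c => (insert (m c) (P c).1, complInsert (m c) (I c) (hm c).2.1))
      (fun c => (P c, I c)) = Matrix.diagonal fun c => (koszulSign (m c) (P c).1 : K) := by
  ext c₁ c
  rw [Matrix.submatrix_apply, koszulFlattening_apply]
  simp only [tensorCoord_tripleWord_perTensor, complInsert, compl_inj_iff]
  have hterm : ∀ a, insert (m c₁) (P c₁).1 = insert a (P c).1 → a ∉ (P c).1 →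
      a ∉ (I c).1 → insert (m c₁) (I c₁).1 = insert a (I c).1 → a = m c ∧ c₁ = c := by
    intro a h1 h2 h3 h4
    obtain ⟨ha, hP, hI⟩ := (hm c).eq_of_insert_eq (hm c₁) h2 h3 h1 h4
    exact ⟨ha, hinj (Prod.ext (Subtype.ext hP) (Subtype.ext hI))⟩
  by_cases hc : c₁ = c
  · subst hc
    rw [Matrix.diagonal_apply_eq, Finset.sum_eq_single (m c₁)]
    · simp [(hm c₁).2.1]
    · intro a _ ha
      split_ifs with h1 h2
      · by_cases h3 : a ∈ (P c₁).1
        · simp [koszulSign_of_mem h3]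
        · exact absurd (hterm a h1 h3 h2.1 h2.2).1 ha
      · simp
      · rfl
    · simp
  · rw [Matrix.diagonal_apply_ne _ hc]
    refine Finset.sum_eq_zero fun a _ => ?_
    split_ifs with h1 h2
    · by_cases h3 : a ∈ (P c).1
      · simp [koszulSign_of_mem h3]
      · exact absurd (hterm a h1 h3 h2.1 h2.2).2 hc
    · simp
    · rfl

theorem card_le_mul_borderRank_perTensor [CharZero K] {κ : Type*} [Fintype κ]
    {P I : κ → KSubset (p + p + 1) p} (hinj : Function.Injective fun c => (P c, I c))
    (h : ∀ c, ∃ m, IsLeastOutside (P c).1 (I c).1 m) :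
    Fintype.card κ ≤ (p + p).choose p * borderRank (perTensor K (p + p + 1)) := by
  classical
  choose m hm using h
  refine card_le_mul_borderRank_of_submatrix (V := fun _ => Fin (p + p + 1) → K)
    koszulFlattening rank_koszulFlattening_tprod_le
    (fun c => (insert (m c) (P c).1, complInsert (m c) (I c) (hm c).2.1))
    (fun c => (P c, I c)) ?_
  rw [koszulFlattening_perTensor_submatrix hinj hm, Matrix.det_diagonal]
  exact Finset.prod_ne_zero_iff.2 fun c _ => koszulSign_cast_ne_zero (hm c).1

theorem card_isLeastOutside_seven :
    821 ≤ Fintype.card {c : KSubset 7 3 × KSubset 7 3 // ∃ m, IsLeastOutside c.1.1 c.2.1 m} := by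
  have h : 821 ≤ (((Finset.powersetCard 3 (Finset.univ : Finset (Fin 7))) ×ˢ
      (Finset.powersetCard 3 (Finset.univ : Finset (Fin 7)))).filter
        fun x => ∃ m, IsLeastOutside x.1 x.2 m).card := by
    decide +kernel
  refine h.trans ?_
  rw [← Finset.card_univ]
  refine Finset.card_le_card_of_surjOn (fun c => (c.1.1.1, c.1.2.1)) ?_
  rintro ⟨P, I⟩ hPI
  simp only [Finset.coe_filter, Finset.mem_product, Finset.mem_powersetCard_univ,
    Set.mem_ofPred_eq] at hPI
  exact ⟨⟨(⟨P, hPI.1.1⟩, ⟨I, hPI.1.2⟩), hPI.2⟩, by simp, rfl⟩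

theorem le_borderRank_perTensor_seven [CharZero K] : 42 ≤ borderRank (perTensor K 7) := by
  have h := card_isLeastOutside_seven.trans <| card_le_mul_borderRank_perTensor (K := K)
    (p := 3) (P := fun c => c.1.1) (I := fun c => c.1.2) Subtype.val_injective fun c => c.2
  have h20 : (3 + 3).choose 3 = 20 := by decide
  rw [h20] at h
  change 821 ≤ 20 * borderRank (perTensor K 7) at h
  lia

end Permanent

/-! ### The border rank of the determinant -/

section Determinant

variable {K : Type*} [Field K] {p : ℕ}

/-- The entries of the inverse of the inclusion matrix between the subsets of size `k` and
those of size `k + 1` of a set of size `2k + 1`, as a function of the size `j` of the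
intersection. -/
def inclusionInverse (K : Type*) [Field K] (k j : ℕ) : K :=
  (-1) ^ (k - j) * (k - j).factorial * j.factorial / (k + 1).factorial

theorem inclusionInverse_self [CharZero K] (k : ℕ) : (k + 1 : K) * inclusionInverse K k k = 1 := by
  have h1 : ((k : K) + 1) ≠ 0 := by exact_mod_cast k.succ_ne_zero
  have h2 : (k.factorial : K) ≠ 0 := by exact_mod_cast k.factorial_ne_zero
  simp only [inclusionInverse, Nat.sub_self, Nat.factorial_succ]
  push_cast
  field_simp
  simp

theorem inclusionInverse_recurrence {k j : ℕ} (h : j < k) :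
    ((k - j : ℕ) : K) * inclusionInverse K k (j + 1) + (j + 1) * inclusionInverse K k j = 0 := by
  obtain ⟨d, rfl⟩ : ∃ d, k = j + 1 + d := ⟨k - (j + 1), by lia⟩
  have h1 : j + 1 + d - j = d + 1 := by lia
  have h2 : j + 1 + d - (j + 1) = d := by lia
  simp only [inclusionInverse, h1, h2, Nat.factorial_succ d, Nat.factorial_succ j, pow_succ]
  push_cast
  ring

/-- `inclusionInverse` inverts the inclusion matrix. -/
theorem sum_inclusionInverse [CharZero K] {α : Type*} [DecidableEq α] {V X X₀ : Finset α} {k : ℕ}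
    (hV : V.card = 2 * k + 1) (hX : X ⊆ V) (hX₀ : X₀ ⊆ V) (hXc : X.card = k)
    (hX₀c : X₀.card = k) :
    ∑ a ∈ V \ X, inclusionInverse K k (insert a X ∩ X₀).card = if X = X₀ then 1 else 0 := by
  set j := (X ∩ X₀).card with hj
  have hterm : ∀ a ∈ V \ X, inclusionInverse K k (insert a X ∩ X₀).card =
      if a ∈ X₀ then inclusionInverse K k (j + 1) else inclusionInverse K k j := by
    intro a ha
    split_ifs with h
    · rw [Finset.insert_inter_of_mem h, Finset.card_insert_of_notMem]
      exact fun h' => (Finset.mem_sdiff.1 ha).2 (Finset.mem_inter.1 h').1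
    · rw [Finset.insert_inter_of_notMem h]
  have hjk : j ≤ k := hXc ▸ Finset.card_le_card Finset.inter_subset_left
  have hin : ((V \ X).filter fun a => a ∈ X₀).card = k - j := by
    have h : (V \ X).filter (fun a => a ∈ X₀) = X₀ \ X := by
      ext a
      have := @hX₀ a
      simp only [Finset.mem_filter, Finset.mem_sdiff]
      tauto
    rw [h, Finset.card_sdiff, hX₀c]
  have hout : ((V \ X).filter fun a => a ∉ X₀).card = j + 1 := by
    have h := Finset.card_filter_add_card_filter_not (s := V \ X) (fun a => a ∈ X₀)
    rw [hin, Finset.card_sdiff_of_subset hX, hV, hXc] at h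
    lia
  rw [Finset.sum_congr rfl hterm, Finset.sum_ite, Finset.sum_const, Finset.sum_const, hin, hout,
    nsmul_eq_mul, nsmul_eq_mul]
  split_ifs with h
  · have hjk' : j = k := by rw [hj, h, Finset.inter_self, hX₀c]
    rw [hjk']
    simpa using inclusionInverse_self k
  · have hlt : j < k := by
      refine lt_of_le_of_ne hjk fun hjk' => h ?_
      have h1 : X ∩ X₀ = X :=
        Finset.eq_of_subset_of_card_le Finset.inter_subset_left (by lia)
      exact Finset.eq_of_subset_of_card_le (Finset.inter_eq_left.1 h1) (by lia)
    simpa using inclusionInverse_recurrence hlt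

/-- For `R` and `S` the set differences of `P` and `I`, the sign by which the basis vector of
`(P, I)` with `P ∩ I = X` has to be multiplied so that the flattening of the determinant becomes
an unsigned inclusion matrix. -/
def gaugeSign {n : ℕ} (R S X : Finset (Fin n)) : ℤ :=
  ∏ b ∈ X, koszulSign b R * koszulSign b S

theorem gaugeSign_mul_self {n : ℕ} {R S X : Finset (Fin n)} (hR : Disjoint X R)
    (hS : Disjoint X S) : gaugeSign R S X * gaugeSign R S X = 1 := by
  rw [gaugeSign, ← Finset.prod_mul_distrib]
  refine Finset.prod_eq_one fun b hb => ?_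
  rw [mul_mul_mul_comm, koszulSign_mul_self (Finset.disjoint_left.1 hR hb),
    koszulSign_mul_self (Finset.disjoint_left.1 hS hb), one_mul]

theorem koszulSign_sdiff_mul_inter {n : ℕ} (a : Fin n) (P I : Finset (Fin n)) :
    koszulSign a (P \ I) * koszulSign a (P ∩ I) = koszulSign a P :=
  (mul_comm _ _).trans (Finset.prod_inter_mul_prod_sdiff P I _)

theorem gaugeSign_insert {n : ℕ} {P I : Finset (Fin n)} {a : Fin n} (hP : a ∉ P) (hI : a ∉ I) :
    gaugeSign (P \ I) (I \ P) (insert a (P ∩ I)) * (koszulSign a P * koszulSign a I) =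
      gaugeSign (P \ I) (I \ P) (P ∩ I) := by
  have ha : a ∉ P ∩ I := fun h => hP (Finset.mem_inter.1 h).1
  have h1 := koszulSign_sdiff_mul_inter a P I
  have h2 := koszulSign_sdiff_mul_inter a I P
  have h3 := koszulSign_mul_self hP
  have h4 := koszulSign_mul_self hI
  rw [Finset.inter_comm] at h2
  rw [gaugeSign, Finset.prod_insert ha, ← gaugeSign]
  have h5 := koszulSign_mul_self ha
  rw [← h1] at h3 ⊢
  rw [← h2] at h4 ⊢
  linear_combination gaugeSign (P \ I) (I \ P) (P ∩ I) *
    (koszulSign a (I \ P) ^ 2 * h3 + h4 - koszulSign a (I \ P) ^ 2 * h5)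

/-- Column by column, the flattening of the determinant is diagonalized by the inverse inclusion
matrices: only pairs with the same set differences are linked, and within such a class the
flattening is an inclusion matrix up to signs. -/
theorem sum_gauge_inclusionInverse [CharZero K] {P₀ I₀ P I : Finset (Fin (p + p + 1))}
    (hP₀ : P₀.card = p) (hP : P.card = p) (hI : I.card = p) :
    ∑ a ∈ (P ∪ I)ᶜ,
      (if insert a P \ insert a I = P₀ \ I₀ ∧ insert a I \ insert a P = I₀ \ P₀ then
      inclusionInverse K (P₀ ∩ I₀).card ((insert a P ∩ insert a I) ∩ (P₀ ∩ I₀)).card *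
        gaugeSign (P₀ \ I₀) (I₀ \ P₀) (insert a P ∩ insert a I) else 0) *
      (koszulSign a P * koszulSign a I : K) =
    if P = P₀ ∧ I = I₀ then (gaugeSign (P₀ \ I₀) (I₀ \ P₀) (P₀ ∩ I₀) : K) else 0 := by
  have hdiff : ∀ a ∈ (P ∪ I)ᶜ, a ∉ P ∧ a ∉ I ∧ insert a P \ insert a I = P \ I ∧
      insert a I \ insert a P = I \ P := by
    intro a ha
    simp only [Finset.mem_compl, Finset.mem_union, not_or] at ha
    refine ⟨ha.1, ha.2, ?_, ?_⟩ <;>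
    · ext b
      simp only [Finset.mem_sdiff, Finset.mem_insert]
      by_cases hb : b = a
      · subst hb; simp [ha.1, ha.2]
      · simp [hb]
  by_cases hRS : P \ I = P₀ \ I₀ ∧ I \ P = I₀ \ P₀
  · obtain ⟨hR, hS⟩ := hRS
    have hcR := Finset.card_sdiff_add_card_inter P I
    have hcR₀ := Finset.card_sdiff_add_card_inter P₀ I₀
    have hcS := Finset.card_sdiff_add_card_inter I P
    rw [hP, hR] at hcR
    rw [hI, Finset.inter_comm, hS] at hcS
    rw [hP₀] at hcR₀
    set k := (P₀ ∩ I₀).card with hk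
    have hX : (P ∩ I).card = k := by lia
    set V := (P \ I ∪ I \ P)ᶜ with hV
    have hVX : (P ∪ I)ᶜ = V \ (P ∩ I) := by
      ext b
      simp only [hV, Finset.mem_compl, Finset.mem_union, Finset.mem_sdiff, Finset.mem_inter]
      tauto
    have hVc : V.card = 2 * k + 1 := by
      rw [hV, Finset.card_compl, Fintype.card_fin, Finset.card_union_of_disjoint, hR, hS]
      · lia
      · exact Finset.disjoint_left.2 fun b h1 h2 =>
          (Finset.mem_sdiff.1 h1).2 (Finset.mem_sdiff.1 h2).1
    have hsub : P ∩ I ⊆ V := by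
      intro b hb
      rw [Finset.mem_inter] at hb
      simp [hV, hb.1, hb.2]
    have hsub₀ : P₀ ∩ I₀ ⊆ V := by
      intro b hb
      rw [Finset.mem_inter] at hb
      rw [hV, hR, hS]
      simp [hb.1, hb.2]
    have hterm : ∀ a ∈ (P ∪ I)ᶜ,
        (if insert a P \ insert a I = P₀ \ I₀ ∧ insert a I \ insert a P = I₀ \ P₀ then
          inclusionInverse K k ((insert a P ∩ insert a I) ∩ (P₀ ∩ I₀)).card *
            gaugeSign (P₀ \ I₀) (I₀ \ P₀) (insert a P ∩ insert a I) else 0) *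
          (koszulSign a P * koszulSign a I : K) =
        inclusionInverse K k (insert a (P ∩ I) ∩ (P₀ ∩ I₀)).card *
          gaugeSign (P₀ \ I₀) (I₀ \ P₀) (P ∩ I) := by
      intro a ha
      obtain ⟨haP, haI, h1, h2⟩ := hdiff a ha
      have hg := gaugeSign_insert haP haI
      rw [hR, hS] at hg
      rw [if_pos ⟨h1.trans hR, h2.trans hS⟩, ← Finset.insert_inter_distrib, ← hg]
      push_cast
      ring
    rw [Finset.sum_congr rfl hterm, ← Finset.sum_mul, hVX,
      sum_inclusionInverse hVc hsub hsub₀ hX rfl]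
    have hiff : P ∩ I = P₀ ∩ I₀ ↔ P = P₀ ∧ I = I₀ := by
      refine ⟨fun h => ⟨?_, ?_⟩, fun h => by rw [h.1, h.2]⟩
      · rw [← Finset.sdiff_union_inter P I, hR, h, Finset.sdiff_union_inter]
      · rw [← Finset.sdiff_union_inter I P, hS, Finset.inter_comm, h, Finset.inter_comm,
          Finset.sdiff_union_inter]
    by_cases h : P ∩ I = P₀ ∩ I₀
    · rw [if_pos h, if_pos (hiff.1 h), one_mul, h]
    · rw [if_neg h, if_neg fun h' => h (hiff.2 h'), zero_mul]
  · rw [if_neg]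
    · refine Finset.sum_eq_zero fun a ha => ?_
      obtain ⟨-, -, h1, h2⟩ := hdiff a ha
      rw [h1, h2, if_neg hRS, zero_mul]
    · rintro ⟨rfl, rfl⟩
      exact hRS ⟨rfl, rfl⟩

/-- The matrix which diagonalizes the flattening of the determinant. A row `(P', J)` of the
flattening stands for the pair `(P', Jᶜ)`. -/
def detFlatteningInverse (K : Type*) [Field K] (p : ℕ) :
    Matrix (KSubset (p + p + 1) p × KSubset (p + p + 1) p)
      (Finset (Fin (p + p + 1)) × KSubset (p + p + 1) p) K :=
  Matrix.of fun c₀ r =>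
    (if r.1 \ r.2.1ᶜ = c₀.1.1 \ c₀.2.1 ∧ r.2.1ᶜ \ r.1 = c₀.2.1 \ c₀.1.1 then
      inclusionInverse K (c₀.1.1 ∩ c₀.2.1).card ((r.1 ∩ r.2.1ᶜ) ∩ (c₀.1.1 ∩ c₀.2.1)).card *
        gaugeSign (c₀.1.1 \ c₀.2.1) (c₀.2.1 \ c₀.1.1) (r.1 ∩ r.2.1ᶜ) else 0) *
      complSign r.2.1ᶜ

theorem detFlatteningInverse_mul [CharZero K] :
    detFlatteningInverse K p * koszulFlattening (detTensor K (p + p + 1)) =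
      Matrix.diagonal fun c =>
        (gaugeSign (c.1.1 \ c.2.1) (c.2.1 \ c.1.1) (c.1.1 ∩ c.2.1) : K) := by
  ext c₀ c
  have hdiag : Matrix.diagonal (fun c : KSubset (p + p + 1) p × KSubset (p + p + 1) p =>
        (gaugeSign (c.1.1 \ c.2.1) (c.2.1 \ c.1.1) (c.1.1 ∩ c.2.1) : K)) c₀ c =
      if c.1.1 = c₀.1.1 ∧ c.2.1 = c₀.2.1 then
        (gaugeSign (c₀.1.1 \ c₀.2.1) (c₀.2.1 \ c₀.1.1) (c₀.1.1 ∩ c₀.2.1) : K) else 0 := by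
    rw [Matrix.diagonal_apply]
    congr 1
    rw [eq_comm (a := c₀), Prod.ext_iff, Subtype.ext_iff, Subtype.ext_iff]
  rw [hdiag, ← sum_gauge_inclusionInverse c₀.1.2 c.1.2 c.2.2, Matrix.mul_apply]
  simp only [koszulFlattening_apply, Finset.mul_sum]
  rw [Finset.sum_comm, ← Finset.sum_subset (Finset.subset_univ (c.1.1 ∪ c.2.1)ᶜ)]
  · refine Finset.sum_congr rfl fun a ha => ?_
    simp only [Finset.mem_compl, Finset.mem_union, not_or] at ha
    -- only the row `(P ∪ {a}, (I ∪ {a})ᶜ)` contributes to the term of `a`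
    rw [Finset.sum_eq_single (insert a c.1.1, complInsert a c.2 ha.2)]
    · rw [if_pos rfl, tensorCoord_tripleWord_detTensor, if_pos ⟨ha.2, rfl⟩]
      have hs : (complSign (insert a c.2.1) : K) * complSign (insert a c.2.1) = 1 := by
        exact_mod_cast congrArg (Int.cast : ℤ → K) (complSign_mul_self (insert a c.2.1))
      simp only [detFlatteningInverse, Matrix.of_apply, complInsert, compl_compl]
      linear_combination (_ * (koszulSign a c.1.1 * koszulSign a c.2.1 : K)) * hs
    · intro r _ hr
      split_ifs with h1
      · rw [tensorCoord_tripleWord_detTensor, if_neg, mul_zero, mul_zero]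
        exact fun h2 => hr (Prod.ext h1 (Subtype.ext h2.2))
      · rw [mul_zero]
    · simp
  · intro a _ ha
    refine Finset.sum_eq_zero fun r _ => ?_
    rw [tensorCoord_tripleWord_detTensor]
    by_cases hP : a ∈ c.1.1
    · simp [koszulSign_of_mem hP]
    · have hI : a ∈ c.2.1 := by
        by_contra hI
        simp [hP, hI] at ha
      simp [hI]

theorem sq_choose_le_mul_borderRank_detTensor [CharZero K] :
    (p + p + 1).choose p ^ 2 ≤
      (p + p).choose p * borderRank (detTensor K (p + p + 1)) := by
  have h := card_le_mul_borderRank (V := fun _ => Fin (p + p + 1) → K)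
    koszulFlattening rank_koszulFlattening_tprod_le (T := detTensor K (p + p + 1))
    (detFlatteningInverse K p) 1 (by
      rw [Matrix.mul_one, detFlatteningInverse_mul, Matrix.det_diagonal]
      refine Finset.prod_ne_zero_iff.2 fun c _ h0 => ?_
      have h1 := gaugeSign_mul_self (X := c.1.1 ∩ c.2.1) (R := c.1.1 \ c.2.1)
        (S := c.2.1 \ c.1.1)
        (Finset.disjoint_left.2 fun b h2 h3 =>
          (Finset.mem_sdiff.1 h3).2 (Finset.mem_inter.1 h2).2)
        (Finset.disjoint_left.2 fun b h2 h3 =>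
          (Finset.mem_sdiff.1 h3).2 (Finset.mem_inter.1 h2).1)
      rw [Int.cast_eq_zero.1 h0] at h1
      simp at h1)
  have hc : Fintype.card (KSubset (p + p + 1) p) = (p + p + 1).choose p := by
    rw [Fintype.card_finset_len, Fintype.card_fin]
  rwa [Fintype.card_prod, hc, ← sq] at h

theorem le_borderRank_detTensor_seven [CharZero K] : 62 ≤ borderRank (detTensor K 7) := by
  have h := sq_choose_le_mul_borderRank_detTensor (K := K) (p := 3)
  have h20 : (3 + 3).choose 3 = 20 := by decide
  have h35 : (3 + 3 + 1).choose 3 = 35 := by decide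
  rw [h20, h35] at h
  change 35 ^ 2 ≤ 20 * borderRank (detTensor K 7) at h
  lia

end Determinant

theorem mainTheorem5 (K : Type*) [Field K] [CharZero K] :
    (42 ≤ borderRank (perTensor K 7) ∧ borderRank (perTensor K 7) ≤ 64) ∧
    (42 ≤ tensorRank (perTensor K 7) ∧ tensorRank (perTensor K 7) ≤ 64) ∧
    (62 ≤ borderRank (detTensor K 7) ∧ borderRank (detTensor K 7) ≤ 3500) ∧
    (62 ≤ tensorRank (detTensor K 7) ∧ tensorRank (detTensor K 7) ≤ 3500) := by
  have hper : 42 ≤ borderRank (perTensor K 7) := le_borderRank_perTensor_seven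
  have hdet : 62 ≤ borderRank (detTensor K 7) := le_borderRank_detTensor_seven
  have hper' : tensorRank (perTensor K 7) ≤ 64 := tensorRank_perTensor_le (n := 6)
  have hdet' : tensorRank (detTensor K 7) ≤ 3500 := tensorRank_detTensor_seven_le
  have hp := borderRank_le_tensorRank (perTensor K 7)
  have hd := borderRank_le_tensorRank (detTensor K 7)
  exact ⟨⟨hper, hp.trans hper'⟩, ⟨hper.trans hp, hper'⟩, ⟨hdet, hd.trans hdet'⟩,
    ⟨hdet.trans hd, hdet'⟩⟩
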